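/- Let $\mathcal{Y}$ be a finite set, let $\mathcal{P}(\mathcal{Y})$ be the simplex of probability vectors on $\mathcal{Y}$, let $\mathcal{X}$ be an arbitrary non-empty input alphabet, and let $W:\mathcal{X}\to\mathcal{P}(\mathcal{Y})$, $x\mapsto W_x$, be a channel. Its memoryless extension is $W^n(E\mid u)=\sum_{y^n\in E}\prod_{i=1}^n W_{u_i}(y_i)$ for $u=(u_1,\dots,u_n)\in\mathcal{X}^n$ and $E\subset\mathcal{Y}^n$. An $(n,N,\lambda_1,\lambda_2)$-DI (deterministic identification) code is a family $\{(u_j,\mathcal{E}_j):1\le j\le N\}$ with $u_j\in\mathcal{X}^n$ and $\mathcal{E}_j\subset\mathcal{Y}^n$ such that $W^n(\mathcal{E}_j\mid u_j)\ge 1-\lambda_1$ for all $j$ and $W^n(\mathcal{E}_k\mid u_j)\le\lambda_2$ for all $j\neq k$. Let $N_{\mathrm{DI}}(n,\lambda_1,\lambda_2)\in\mathbb{N}\cup\{\infty\}$ be the supremum of all $N$ for which such a code exists, and define the pessimistic slightly superexponential DI capacity, with values in the extended reals, by $$\dot C_{\mathrm{DI}}(W)=\inf_{\lambda_1,\lambda_2>0}\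 \liminf_{n\to\infty}\frac{\log N_{\mathrm{DI}}(n,\lambda_1,\lambda_2)}{n\log n}.$$ Let $\sqrt{\widetilde{\mathcal{X}}}=\{(\sqrt{W_x(y)})_{y\in\mathcal{Y}}:x\in\mathcal{X}\}\subset\mathbb{R}^{\mathcal{Y}}$ with the Euclidean metric. For a non-empty bounded set $F$ let $\underline{d}_M(F)=\liminf_{\delta\to 0^+}\frac{\log\Gamma_\delta(F)}{-\log\delta}$ be its lower Minkowski dimension, where $\Gamma_\delta(F)$ is the minimum number of closed balls of radius $\delta$ centred at points of $F$ whose union contains $F$. Then for all $\lambda_1,\lambda_2>0$ with $\lambda_1+\lambda_2<1$, $$\tfrac14\,\underline{d}_M\bigl(\sqrt{\widetilde{\mathcal{X}}}\bigr)\ \le\ \dot C_{\mathrm{DI}}(W)\ \le\ \liminf_{n\to\infty}\frac{\log N_{\mathrm{DI}}(n,\lambda_1,\lambda_2)}{n\log n}\ \le\ \tfrac12\,\underline{d}_M\bigl(\sqrt{\widetilde{\mathcal{X}}}\bigr).$$ -/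

import Mathlib

open Filter Topology
open scoped NNReal ENNReal

namespace DetIdent

noncomputable section

/-- The `n`-fold memoryless extension of a channel `W`, mapping each input `x` to a point of the
probability simplex over the finite output alphabet: the probability
`W^n(E | u) = ∑_{y ∈ E} ∏ i, W(y i | u i)` of a set `E` of output words, given the input word `u`. -/
def blockProb {X Y : Type*} [Fintype Y] (W : X → stdSimplex ℝ Y) {n : ℕ} (u : Fin n → X)
    (E : Finset (Fin n → Y)) : ℝ :=
  ∑ y ∈ E, ∏ i, (W (u i) : Y → ℝ) (y i)

/-- An `(n, N, lam₁, lam₂)` deterministic identification code over `n` uses of the channel `W`: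
code words `u j` and (not necessarily disjoint) decoding sets `E j`, `j = 1, …, N`. -/
structure DICode {X Y : Type*} [Fintype Y] (W : X → stdSimplex ℝ Y) (n N : ℕ)
    (lam₁ lam₂ : ℝ) where
  /-- the code words -/
  u : Fin N → Fin n → X
  /-- the decoding sets -/
  E : Fin N → Finset (Fin n → Y)
  /-- errors of the first kind (missed identification) -/
  first_kind : ∀ j, 1 - lam₁ ≤ blockProb W (u j) (E j)
  /-- errors of the second kind (false identification) -/
  second_kind : ∀ j k, j ≠ k → blockProb W (u j) (E k) ≤ lam₂

/-- `N_DI(n, lam₁, lam₂)`: the largest `N` such that an `(n, N, lam₁, lam₂)` DI code exists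
(`⊤` if there are such codes of arbitrarily large size). -/
def maxSize {X Y : Type*} [Fintype Y] (W : X → stdSimplex ℝ Y) (n : ℕ)
    (lam₁ lam₂ : ℝ) : ℕ∞ :=
  ⨆ (N : ℕ) (_ : Nonempty (DICode W n N lam₁ lam₂)), (N : ℕ∞)

/-- `liminf_{n → ∞} log N_DI(n, lam₁, lam₂) / (n log n)`, in the extended reals.
The quotient does not depend on the base of the logarithms. -/
def pessimisticRate {X Y : Type*} [Fintype Y] (W : X → stdSimplex ℝ Y) (lam₁ lam₂ : ℝ) : EReal :=
  liminf (fun n : ℕ ↦ ENNReal.log (maxSize W n lam₁ lam₂ : ℝ≥0∞) /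
    (((n : ℝ) * Real.log n : ℝ) : EReal)) atTop

/-- The (pessimistic) slightly superexponential DI capacity: the infimum over all
`lam₁, lam₂ > 0` of `liminf_{n → ∞} log N_DI(n, lam₁, lam₂) / (n log n)`. -/
def capacity {X Y : Type*} [Fintype Y] (W : X → stdSimplex ℝ Y) : EReal :=
  ⨅ (lam₁ : ℝ) (lam₂ : ℝ) (_ : 0 < lam₁) (_ : 0 < lam₂), pessimisticRate W lam₁ lam₂

/-- The lower Minkowski dimension `liminf_{δ → 0+} log Γ_δ(F) / (-log δ)`, where `Γ_δ(F)` is the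
least number of closed balls of radius `δ` centred in `F` that cover `F`. -/
def lowerMinkowskiDim {M : Type*} [MetricSpace M] (F : Set M) : EReal :=
  liminf (fun δ : ℝ≥0 ↦ ENNReal.log (Metric.coveringNumber δ F : ℝ≥0∞) /
    ((-Real.log δ : ℝ) : EReal)) (𝓝[>] 0)

/-- The set of all `√(W_x) = (√(W(y|x)))_y`, in Euclidean space `ℝ^Y`. -/
def sqrtOutputSet {X Y : Type*} [Fintype Y] (W : X → stdSimplex ℝ Y) :
    Set (EuclideanSpace ℝ Y) :=
  Set.range fun x : X ↦ WithLp.toLp 2 fun y : Y ↦ √((W x : Y → ℝ) y)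

end

end DetIdent

/-!
Everything rests on the squared Hellinger distance `∑ i, ‖√(W_{u i}) - √(W_{v i})‖²` of two input
words `u` and `v`. It controls how well the output distributions `P` and `Q` of the two words can be
told apart, because their Bhattacharyya coefficient is multiplicative
(`sum_sqrt_prod_mul_sqrt_prod`).

*Achievability.* Decode `u` by its entropy-typical set, the output words whose information content
is within `K √n` of its mean; by Chebyshev's inequality it has probability close to one
(`sum_compl_typicalSet_le`), uniformly in the channel. If `P` and `Q` have the same entropy up to
`O(√n)`, then their densities differ on the intersection of the two typical sets by a factor
`exp (O(√n))` at most, and so the false identification probability is at most a small constant plus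
`exp (O(√n)) · ∑ √(P Q)` (`sum_typicalSet_le`). It is thus small as soon as the squared Hellinger
distance is of larger order than `√n`. To achieve this, take letters from a `δ`-separated subset of
the square-root output set with `δ = n ^ (-(1/4 - θ))`, and words over this alphabet with pairwise
Hamming distance above `θ n`, whose number is bounded below by a Gilbert–Varshamov argument.
Sorting the words by entropy into `n + 1` classes (`exists_hamming_code`) costs only a polynomial
factor. This gives about `Γ_δ ^ n` words (`exists_DICode_of_separated`), and `-log δ` is almost
`(log n) / 4`.

*Converse.* If the squared Hellinger distance of two words is small, then so is the total variation
distance of their output distributions (`sq_sum_sub_sum_le`), and they cannot both belong to a code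
with `lam₁ + lam₂ < 1`. For `δ = c / √n` with a small constant `c`, rounding the letters to a
`δ`-covering is therefore injective on code words, and a code has at most `Γ_δ ^ n` words
(`maxSize_le_coveringNumber_pow`). Here `-log δ` is about `(log n) / 2`.
-/

namespace DetIdent

/-! ### Product distributions: typical sets and Hellinger distance -/

section ProductDistributions

variable {ι Y : Type*} [Fintype ι] [Fintype Y]

lemma sum_prod_eq_prod_sum (f : ι → Y → ℝ) [DecidableEq ι] :
    ∑ y : ι → Y, ∏ i, f i (y i) = ∏ i, ∑ b, f i b :=
  (Fintype.prod_sum f).symm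

/-- Under a product distribution, the second moment of a sum of centred functions of the single
coordinates is the sum of the second moments. -/
lemma sum_prod_mul_sq_sum [DecidableEq ι] {p g : ι → Y → ℝ} (hp : ∀ i, ∑ b, p i b = 1)
    (hg : ∀ i, ∑ b, p i b * g i b = 0) :
    ∑ y : ι → Y, (∏ i, p i (y i)) * (∑ i, g i (y i)) ^ 2 = ∑ i, ∑ b, p i b * g i b ^ 2 := by
  have key : ∀ i j, ∑ y : ι → Y, (∏ k, p k (y k)) * (g i (y i) * g j (y j)) =
      if i = j then ∑ b, p i b * g i b ^ 2 else 0 := by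
    intro i j
    have h1 : ∀ y : ι → Y, (∏ k, p k (y k)) * (g i (y i) * g j (y j)) =
        ∏ k, (p k (y k) * ((if k = i then g k (y k) else 1) *
          (if k = j then g k (y k) else 1))) := by
      intro y
      rw [Finset.prod_mul_distrib, Finset.prod_mul_distrib]
      simp
    simp_rw [h1]
    rw [sum_prod_eq_prod_sum
      (fun k b ↦ p k b * ((if k = i then g k b else 1) * (if k = j then g k b else 1)))]
    split_ifs with hij
    · subst hij
      rw [Finset.prod_eq_single i]
      · simp [sq]
      · intro k _ hk
        simp [hk, hp]
      · simp
    · apply Finset.prod_eq_zero (Finset.mem_univ i)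
      simp [hij, hg]
  simp_rw [sq (∑ i, g i _), Finset.sum_mul_sum, Finset.mul_sum]
  rw [Finset.sum_comm]
  refine Finset.sum_congr rfl fun i _ ↦ ?_
  rw [Finset.sum_comm]
  simp [key]

/-- The Shannon entropy (in nats) of the product distribution with marginals `p i`. -/
noncomputable def prodEntropy (p : ι → Y → ℝ) : ℝ := ∑ i, ∑ b, Real.negMulLog (p i b)

open scoped Classical in
/-- The entropy-typical set of the product distribution `P` with marginals `p i`: the words of
positive probability whose information content `-log P(y)` is within `T` of the entropy. Words of
probability zero are excluded explicitly, because of `Real.log 0 = 0`. -/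
noncomputable def typicalSet (p : ι → Y → ℝ) (T : ℝ) : Finset (ι → Y) :=
  {y | 0 < ∏ i, p i (y i) ∧ |Real.log (∏ i, p i (y i)) + prodEntropy p| ≤ T}

lemma mem_typicalSet {p : ι → Y → ℝ} {T : ℝ} {y : ι → Y} : y ∈ typicalSet p T ↔
    0 < ∏ i, p i (y i) ∧ |Real.log (∏ i, p i (y i)) + prodEntropy p| ≤ T := by
  simp [typicalSet]

lemma mul_log_sq_le {x : ℝ} (h0 : 0 ≤ x) (h1 : x ≤ 1) : x * Real.log x ^ 2 ≤ 4 := by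
  rcases h0.eq_or_lt with rfl | h0
  · simp
  -- Apply `|log z * z| < 1` to `z = √x` and square.
  have h := Real.abs_log_mul_self_lt (√x) (Real.sqrt_pos.2 h0) (Real.sqrt_le_one.2 h1)
  rw [Real.log_sqrt h0.le] at h
  have h2 := (sq_lt_one_iff_abs_lt_one _).2 h
  rw [mul_pow, Real.sq_sqrt h0.le] at h2
  nlinarith

lemma negMulLog_le_one {x : ℝ} (h0 : 0 ≤ x) (h1 : x ≤ 1) : Real.negMulLog x ≤ 1 := by
  rcases h0.eq_or_lt with rfl | h0
  · simp
  have h := (abs_lt.1 (Real.abs_log_mul_self_lt x h0 h1)).1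
  rw [Real.negMulLog]
  linarith

lemma le_one_of_sum_eq_one {p : Y → ℝ} (h0 : ∀ b, 0 ≤ p b) (h1 : ∑ b, p b = 1) (b : Y) :
    p b ≤ 1 :=
  h1 ▸ Finset.single_le_sum (fun b _ ↦ h0 b) (Finset.mem_univ b)

lemma prodEntropy_nonneg {p : ι → Y → ℝ} (h0 : ∀ i b, 0 ≤ p i b) (h1 : ∀ i, ∑ b, p i b = 1) :
    0 ≤ prodEntropy p :=
  Finset.sum_nonneg fun i _ ↦ Finset.sum_nonneg fun b _ ↦
    Real.negMulLog_nonneg (h0 i b) (le_one_of_sum_eq_one (h0 i) (h1 i) b)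

lemma prodEntropy_le {p : ι → Y → ℝ} (h0 : ∀ i b, 0 ≤ p i b) (h1 : ∀ i, ∑ b, p i b = 1) :
    prodEntropy p ≤ Fintype.card ι * Fintype.card Y := by
  have : prodEntropy p ≤ ∑ _i : ι, ∑ _b : Y, (1 : ℝ) :=
    Finset.sum_le_sum fun i _ ↦ Finset.sum_le_sum fun b _ ↦
      negMulLog_le_one (h0 i b) (le_one_of_sum_eq_one (h0 i) (h1 i) b)
  simpa using this

/-- Chebyshev's inequality for the information content: the variance of `-log p(b)` is at most
`4 |Y|` for each marginal, whatever the distribution. -/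
lemma sum_compl_typicalSet_le [DecidableEq ι] [DecidableEq Y]
    {p : ι → Y → ℝ} (h0 : ∀ i b, 0 ≤ p i b)
    (h1 : ∀ i, ∑ b, p i b = 1) {T : ℝ} (hT : 0 < T) :
    ∑ y ∈ (typicalSet p T)ᶜ, ∏ i, p i (y i) ≤
      4 * Fintype.card ι * Fintype.card Y / T ^ 2 := by
  -- A letter `b` with `p i b = 0` carries no mass, so the value `Real.log 0 = 0` is harmless here.
  set g : ι → Y → ℝ := fun i b ↦ Real.log (p i b) + ∑ c, Real.negMulLog (p i c) with hg
  have hneg : ∀ i, ∑ b, p i b * Real.log (p i b) = - ∑ c, Real.negMulLog (p i c) := by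
    intro i
    simp [Real.negMulLog]
  have hcent : ∀ i, ∑ b, p i b * g i b = 0 := by
    intro i
    simp only [hg, mul_add, Finset.sum_add_distrib, ← Finset.sum_mul, h1, hneg]
    ring
  have hvar : ∀ i, ∑ b, p i b * g i b ^ 2 ≤ 4 * Fintype.card Y := by
    intro i
    have e : ∑ b, p i b * g i b ^ 2 = ∑ b, p i b * Real.log (p i b) ^ 2
        - (∑ c, Real.negMulLog (p i c)) ^ 2 := by
      have : ∀ b, p i b * g i b ^ 2 = p i b * Real.log (p i b) ^ 2
          + (p i b * Real.log (p i b)) * (2 * ∑ c, Real.negMulLog (p i c))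
          + p i b * (∑ c, Real.negMulLog (p i c)) ^ 2 := by
        intro b
        simp only [hg]
        ring
      simp only [this, Finset.sum_add_distrib, ← Finset.sum_mul, h1, hneg]
      ring
    have : ∑ b, p i b * Real.log (p i b) ^ 2 ≤ ∑ _b : Y, (4 : ℝ) :=
      Finset.sum_le_sum fun b _ ↦ mul_log_sq_le (h0 i b) (le_one_of_sum_eq_one (h0 i) (h1 i) b)
    simp only [Finset.sum_const, Finset.card_univ, nsmul_eq_mul] at this
    nlinarith [sq_nonneg (∑ c, Real.negMulLog (p i c))]
  have hnn : ∀ y : ι → Y, 0 ≤ ∏ i, p i (y i) := fun y ↦ Finset.prod_nonneg fun i _ ↦ h0 i _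
  have hpt : ∀ y ∈ (typicalSet p T)ᶜ,
      (∏ i, p i (y i)) * T ^ 2 ≤ (∏ i, p i (y i)) * (∑ i, g i (y i)) ^ 2 := by
    intro y hy
    rcases (hnn y).eq_or_lt with h | h
    · simp [← h]
    rw [Finset.mem_compl, mem_typicalSet, not_and, not_le] at hy
    have hlt := hy h
    have hlog : Real.log (∏ i, p i (y i)) = ∑ i, Real.log (p i (y i)) := by
      apply Real.log_prod
      intro i _ hi
      exact h.ne' (Finset.prod_eq_zero (Finset.mem_univ i) hi)
    have hS : ∑ i, g i (y i) = Real.log (∏ i, p i (y i)) + prodEntropy p := by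
      rw [hlog, prodEntropy, ← Finset.sum_add_distrib]
    rw [hS]
    refine mul_le_mul_of_nonneg_left ?_ h.le
    rw [← sq_abs (_ + _)]
    exact pow_le_pow_left₀ hT.le hlt.le 2
  rw [le_div_iff₀ (by positivity), Finset.sum_mul]
  calc _ ≤ ∑ y ∈ (typicalSet p T)ᶜ, (∏ i, p i (y i)) * (∑ i, g i (y i)) ^ 2 :=
        Finset.sum_le_sum hpt
    _ ≤ ∑ y : ι → Y, (∏ i, p i (y i)) * (∑ i, g i (y i)) ^ 2 :=
        Finset.sum_le_sum_of_subset_of_nonneg (Finset.subset_univ _)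
          fun y _ _ ↦ mul_nonneg (hnn y) (sq_nonneg _)
    _ = ∑ i, ∑ b, p i b * g i b ^ 2 := sum_prod_mul_sq_sum h1 hcent
    _ ≤ ∑ _i : ι, (4 * Fintype.card Y : ℝ) := Finset.sum_le_sum fun i _ ↦ hvar i
    _ = _ := by simp; ring

/-- The Bhattacharyya coefficient of two product distributions is the product of those of the
marginals, here expressed by their squared Hellinger distances. -/
lemma sum_sqrt_prod_mul_sqrt_prod [DecidableEq ι] {p q : ι → Y → ℝ} (hp0 : ∀ i b, 0 ≤ p i b)
    (hp1 : ∀ i, ∑ b, p i b = 1) (hq0 : ∀ i b, 0 ≤ q i b) (hq1 : ∀ i, ∑ b, q i b = 1) :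
    ∑ y : ι → Y, √(∏ i, p i (y i)) * √(∏ i, q i (y i)) =
      ∏ i, (1 - (∑ b, (√(p i b) - √(q i b)) ^ 2) / 2) := by
  have h : ∀ y : ι → Y, √(∏ i, p i (y i)) * √(∏ i, q i (y i)) =
      ∏ i, √(p i (y i)) * √(q i (y i)) := by
    intro y
    rw [Real.sqrt_prod _ fun i _ ↦ hp0 i _, Real.sqrt_prod _ fun i _ ↦ hq0 i _,
      Finset.prod_mul_distrib]
  simp_rw [h]
  rw [sum_prod_eq_prod_sum (fun i b ↦ √(p i b) * √(q i b))]
  refine Finset.prod_congr rfl fun i _ ↦ ?_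
  have : ∀ b, (√(p i b) - √(q i b)) ^ 2 = p i b + q i b - 2 * (√(p i b) * √(q i b)) := by
    intro b
    rw [sub_sq, Real.sq_sqrt (hp0 i b), Real.sq_sqrt (hq0 i b)]
    ring
  simp_rw [this, Finset.sum_sub_distrib, Finset.sum_add_distrib, hp1, hq1, ← Finset.mul_sum]
  ring

lemma sum_sq_sqrt_sub_le_two {p q : Y → ℝ} (hp0 : ∀ b, 0 ≤ p b)
    (hp1 : ∑ b, p b = 1) (hq0 : ∀ b, 0 ≤ q b) (hq1 : ∑ b, q b = 1) :
    ∑ b, (√(p b) - √(q b)) ^ 2 ≤ 2 := by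
  calc _ ≤ ∑ b, (p b + q b) := by
        refine Finset.sum_le_sum fun b _ ↦ ?_
        rw [sub_sq, Real.sq_sqrt (hp0 b), Real.sq_sqrt (hq0 b)]
        nlinarith [mul_nonneg (Real.sqrt_nonneg (p b)) (Real.sqrt_nonneg (q b))]
    _ = 2 := by rw [Finset.sum_add_distrib, hp1, hq1]; norm_num

/-- If two product distributions have almost the same entropy, then on the intersection of their
typical sets the probabilities differ by a factor of at most `exp (2 * T + L)`, so that the
probability of that intersection is controlled by the Bhattacharyya coefficient. -/
lemma sum_typicalSet_le [DecidableEq ι] [DecidableEq Y] {p q : ι → Y → ℝ}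
    (hp0 : ∀ i b, 0 ≤ p i b) (hp1 : ∀ i, ∑ b, p i b = 1)
    (hq0 : ∀ i b, 0 ≤ q i b) (hq1 : ∀ i, ∑ b, q i b = 1) {T L : ℝ} (hT : 0 < T)
    (hL : |prodEntropy p - prodEntropy q| ≤ L) :
    ∑ y ∈ typicalSet p T, ∏ i, q i (y i) ≤
      4 * Fintype.card ι * Fintype.card Y / T ^ 2 +
        Real.exp (T + L / 2 - (∑ i, ∑ b, (√(p i b) - √(q i b)) ^ 2) / 2) := by
  have hqnn : ∀ y : ι → Y, 0 ≤ ∏ i, q i (y i) := fun y ↦ Finset.prod_nonneg fun i _ ↦ hq0 i _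
  have hsplit : ∑ y ∈ typicalSet p T, ∏ i, q i (y i) ≤
      ∑ y ∈ (typicalSet q T)ᶜ, ∏ i, q i (y i) +
        ∑ y ∈ typicalSet p T ∩ typicalSet q T, ∏ i, q i (y i) := by
    rw [← Finset.sum_inter_add_sum_sdiff (typicalSet p T) (typicalSet q T), add_comm]
    gcongr
    · exact fun _ _ _ ↦ hqnn _
    · intro y hy
      simp only [Finset.mem_sdiff] at hy
      simpa using hy.2
  refine hsplit.trans (add_le_add (sum_compl_typicalSet_le hq0 hq1 hT) ?_)
  have hpt : ∀ y ∈ typicalSet p T ∩ typicalSet q T, ∏ i, q i (y i) ≤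
      Real.exp (T + L / 2) * (√(∏ i, p i (y i)) * √(∏ i, q i (y i))) := by
    intro y hy
    rw [Finset.mem_inter, mem_typicalSet, mem_typicalSet] at hy
    obtain ⟨⟨hP, hPt⟩, hQ, hQt⟩ := hy
    rw [abs_le] at hPt hQt hL
    have hlog : Real.log (∏ i, q i (y i)) ≤ 2 * T + L + Real.log (∏ i, p i (y i)) := by
      linarith
    have hle : ∏ i, q i (y i) ≤ Real.exp (T + L / 2) ^ 2 * ∏ i, p i (y i) := by
      rw [← Real.exp_log hQ, ← Real.exp_log hP, ← Real.exp_nat_mul, ← Real.exp_add,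
        Real.exp_le_exp]
      push_cast
      linarith
    have hs : √(∏ i, q i (y i)) ≤ Real.exp (T + L / 2) * √(∏ i, p i (y i)) := by
      rw [← Real.sqrt_sq (Real.exp_pos (T + L / 2)).le, ← Real.sqrt_mul (sq_nonneg _)]
      exact Real.sqrt_le_sqrt hle
    calc ∏ i, q i (y i) = √(∏ i, q i (y i)) * √(∏ i, q i (y i)) :=
          (Real.mul_self_sqrt hQ.le).symm
      _ ≤ _ := by
        rw [← mul_assoc]
        exact mul_le_mul_of_nonneg_right hs (Real.sqrt_nonneg _)
  calc _ ≤ ∑ y ∈ typicalSet p T ∩ typicalSet q T,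
          Real.exp (T + L / 2) * (√(∏ i, p i (y i)) * √(∏ i, q i (y i))) :=
        Finset.sum_le_sum hpt
    _ ≤ ∑ y : ι → Y, Real.exp (T + L / 2) * (√(∏ i, p i (y i)) * √(∏ i, q i (y i))) :=
        Finset.sum_le_sum_of_subset_of_nonneg (Finset.subset_univ _)
          fun y _ _ ↦ by positivity
    _ = Real.exp (T + L / 2) * ∏ i, (1 - (∑ b, (√(p i b) - √(q i b)) ^ 2) / 2) := by
        rw [← Finset.mul_sum, sum_sqrt_prod_mul_sqrt_prod hp0 hp1 hq0 hq1]
    _ ≤ Real.exp (T + L / 2) * ∏ i, Real.exp (-((∑ b, (√(p i b) - √(q i b)) ^ 2) / 2)) := by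
        refine mul_le_mul_of_nonneg_left (Finset.prod_le_prod (fun i _ ↦ ?_) fun i _ ↦ ?_)
          (Real.exp_pos _).le
        · linarith [sum_sq_sqrt_sub_le_two (hp0 i) (hp1 i) (hq0 i) (hq1 i)]
        · exact Real.one_sub_le_exp_neg _
    _ = _ := by
        rw [← Real.exp_sum, ← Real.exp_add, Finset.sum_neg_distrib, ← Finset.sum_div,
          ← sub_eq_add_neg]

lemma one_sub_sum_le_prod_one_sub {κ : Type*} (s : Finset κ) (f : κ → ℝ) (h0 : ∀ i, 0 ≤ f i)
    (h1 : ∀ i, f i ≤ 1) :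
    1 - ∑ i ∈ s, f i ≤ ∏ i ∈ s, (1 - f i) := by
  classical
  induction s using Finset.induction_on with
  | empty => simp
  | insert a s ha ih =>
    rw [Finset.sum_insert ha, Finset.prod_insert ha]
    have : 0 ≤ ∑ i ∈ s, f i := Finset.sum_nonneg fun i _ ↦ h0 i
    nlinarith [mul_le_mul_of_nonneg_left ih (sub_nonneg.2 (h1 a)), mul_nonneg (h0 a) this]

/-- A bound for the total variation distance of two product distributions by the Hellinger
distances of their marginals. -/
lemma sq_sum_sub_sum_le [DecidableEq ι] {p q : ι → Y → ℝ} (hp0 : ∀ i b, 0 ≤ p i b)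
    (hp1 : ∀ i, ∑ b, p i b = 1) (hq0 : ∀ i b, 0 ≤ q i b) (hq1 : ∀ i, ∑ b, q i b = 1)
    (E : Finset (ι → Y)) :
    (∑ y ∈ E, ∏ i, p i (y i) - ∑ y ∈ E, ∏ i, q i (y i)) ^ 2 ≤
      4 * ∑ i, ∑ b, (√(p i b) - √(q i b)) ^ 2 := by
  set P : (ι → Y) → ℝ := fun y ↦ ∏ i, p i (y i)
  set Q : (ι → Y) → ℝ := fun y ↦ ∏ i, q i (y i)
  have hP0 : ∀ y, 0 ≤ P y := fun y ↦ Finset.prod_nonneg fun i _ ↦ hp0 i _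
  have hQ0 : ∀ y, 0 ≤ Q y := fun y ↦ Finset.prod_nonneg fun i _ ↦ hq0 i _
  have hP1 : ∑ y, P y = 1 := by simp [P, sum_prod_eq_prod_sum p, hp1]
  have hQ1 : ∑ y, Q y = 1 := by simp [Q, sum_prod_eq_prod_sum q, hq1]
  have e : ∑ y ∈ E, P y - ∑ y ∈ E, Q y = ∑ y ∈ E, (√(P y) - √(Q y)) * (√(P y) + √(Q y)) := by
    rw [← Finset.sum_sub_distrib]
    refine Finset.sum_congr rfl fun y _ ↦ ?_
    nlinarith [Real.sq_sqrt (hP0 y), Real.sq_sqrt (hQ0 y)]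
  have hminus : ∑ y ∈ E, (√(P y) - √(Q y)) ^ 2 ≤ ∑ i, ∑ b, (√(p i b) - √(q i b)) ^ 2 := by
    calc _ ≤ ∑ y, (√(P y) - √(Q y)) ^ 2 :=
          Finset.sum_le_sum_of_subset_of_nonneg (Finset.subset_univ _) fun y _ _ ↦ sq_nonneg _
      _ = ∑ y, (P y + Q y - 2 * (√(P y) * √(Q y))) := by
          refine Finset.sum_congr rfl fun y _ ↦ ?_
          rw [sub_sq, Real.sq_sqrt (hP0 y), Real.sq_sqrt (hQ0 y)]
          ring
      _ = 2 - 2 * ∏ i, (1 - (∑ b, (√(p i b) - √(q i b)) ^ 2) / 2) := by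
          rw [← sum_sqrt_prod_mul_sqrt_prod hp0 hp1 hq0 hq1, Finset.sum_sub_distrib,
            Finset.sum_add_distrib, hP1, hQ1, ← Finset.mul_sum]
          norm_num [P, Q]
      _ ≤ _ := by
          have := one_sub_sum_le_prod_one_sub Finset.univ
            (fun i ↦ (∑ b, (√(p i b) - √(q i b)) ^ 2) / 2)
            (fun i ↦ by positivity)
            fun i ↦ by linarith [sum_sq_sqrt_sub_le_two (hp0 i) (hp1 i) (hq0 i) (hq1 i)]
          rw [← Finset.sum_div] at this
          linarith
  have hplus : ∑ y ∈ E, (√(P y) + √(Q y)) ^ 2 ≤ 4 := by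
    calc _ ≤ ∑ y, (√(P y) + √(Q y)) ^ 2 :=
          Finset.sum_le_sum_of_subset_of_nonneg (Finset.subset_univ _) fun y _ _ ↦ sq_nonneg _
      _ ≤ ∑ y, 2 * (P y + Q y) := by
          refine Finset.sum_le_sum fun y _ ↦ ?_
          nlinarith [Real.sq_sqrt (hP0 y), Real.sq_sqrt (hQ0 y), sq_nonneg (√(P y) - √(Q y))]
      _ = 4 := by rw [← Finset.mul_sum, Finset.sum_add_distrib, hP1, hQ1]; norm_num
  change (∑ y ∈ E, P y - ∑ y ∈ E, Q y) ^ 2 ≤ _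
  rw [e]
  refine (Finset.sum_mul_sq_le_sq_mul_sq E _ _).trans ?_
  have : 0 ≤ ∑ y ∈ E, (√(P y) - √(Q y)) ^ 2 := Finset.sum_nonneg fun y _ ↦ sq_nonneg _
  nlinarith

end ProductDistributions

/-! ### Codes with large Hamming distance -/

section Separation

/-- The greedy (Gilbert–Varshamov) bound: a maximal set of pairwise unrelated elements has the
whole of `S` in the union of its neighbourhoods. -/
lemma exists_pairwise_not_rel_card_le {α : Type*} [DecidableEq α] (S : Finset α)
    (R : α → α → Prop) [DecidableRel R] (hrefl : ∀ x, R x x) (hsymm : ∀ x y, R x y → R y x)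
    (b : ℕ) (hb : ∀ x, (S.filter (R x)).card ≤ b) :
    ∃ C ⊆ S, (∀ x ∈ C, ∀ y ∈ C, x ≠ y → ¬ R x y) ∧ S.card ≤ C.card * b := by
  obtain ⟨C, hC, hmax⟩ := Finset.exists_max_image
    (S.powerset.filter fun C ↦ ∀ x ∈ C, ∀ y ∈ C, x ≠ y → ¬ R x y) Finset.card ⟨∅, by simp⟩
  rw [Finset.mem_filter, Finset.mem_powerset] at hC
  refine ⟨C, hC.1, hC.2, ?_⟩
  have hcov : S ⊆ C.biUnion fun x ↦ S.filter (R x) := by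
    intro y hy
    by_contra hyc
    simp only [Finset.mem_biUnion, Finset.mem_filter, not_exists, not_and] at hyc
    have hyC : y ∉ C := fun h ↦ hyc y h hy (hrefl y)
    have hins := hmax (insert y C) (by
      rw [Finset.mem_filter, Finset.mem_powerset]
      refine ⟨Finset.insert_subset hy hC.1, ?_⟩
      intro x hx z hz hxz
      rcases Finset.mem_insert.1 hx with rfl | hx' <;>
        rcases Finset.mem_insert.1 hz with rfl | hz'
      · exact absurd rfl hxz
      · exact fun h ↦ hyc z hz' hy (hsymm _ _ h)
      · exact hyc x hx' hy
      · exact hC.2 x hx' z hz' hxz)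
    rw [Finset.card_insert_of_notMem hyC] at hins
    omega
  exact (Finset.card_le_card hcov).trans (Finset.card_biUnion_le_card_mul _ _ _ fun x _ ↦ hb x)

/-- A Hamming ball of radius `t` is covered by at most `2 ^ n` subcubes of dimension at most
`t`, one for each set of coordinates in which a word may differ from the centre. -/
lemma card_hammingDist_le {ι A : Type*} [Fintype ι] [DecidableEq ι] [Fintype A] [DecidableEq A]
    [Nonempty A] (u : ι → A) (t : ℕ) :
    (Finset.univ.filter fun v ↦ hammingDist u v ≤ t).card ≤
      2 ^ Fintype.card ι * Fintype.card A ^ t := by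
  have hA : 1 ≤ Fintype.card A := Fintype.card_pos
  have hsub : (Finset.univ.filter fun v ↦ hammingDist u v ≤ t) ⊆
      ((Finset.univ : Finset ι).powerset.filter fun D ↦ D.card ≤ t).biUnion fun D ↦
        Fintype.piFinset fun i ↦ if i ∈ D then Finset.univ else {u i} := by
    intro v hv
    rw [Finset.mem_filter] at hv
    rw [Finset.mem_biUnion]
    refine ⟨Finset.univ.filter fun i ↦ u i ≠ v i, by simpa [hammingDist] using hv.2, ?_⟩
    rw [Fintype.mem_piFinset]
    intro i
    by_cases h : u i = v i <;> simp [h]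
  calc _ ≤ _ := Finset.card_le_card hsub
    _ ≤ ((Finset.univ : Finset ι).powerset.filter fun D ↦ D.card ≤ t).card *
          Fintype.card A ^ t := by
        refine Finset.card_biUnion_le_card_mul _ _ _ fun D hD ↦ ?_
        rw [Finset.mem_filter] at hD
        rw [Fintype.card_piFinset]
        calc _ = Fintype.card A ^ D.card := by
              simp [apply_ite Finset.card, Finset.prod_ite_mem]
          _ ≤ _ := Nat.pow_le_pow_right hA hD.2
    _ ≤ _ := by
        refine Nat.mul_le_mul_right _ ((Finset.card_filter_le _ _).trans ?_)
        simp

/-- Among the words over a finite alphabet, sorted into `B + 1` classes, there is a large code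
contained in one class with minimum Hamming distance greater than `t`. -/
lemma exists_hamming_code {ι A : Type*} [Fintype ι] [DecidableEq ι] [Fintype A] [DecidableEq A]
    [Nonempty A] (f : (ι → A) → ℕ) (B t : ℕ) (hf : ∀ u, f u ≤ B) :
    ∃ C : Finset (ι → A), (∀ u ∈ C, ∀ v ∈ C, f u = f v) ∧
      (∀ u ∈ C, ∀ v ∈ C, u ≠ v → t < hammingDist u v) ∧
      (Fintype.card A : ℝ) ^ Fintype.card ι ≤
        (B + 1) * (C.card * (2 ^ Fintype.card ι * Fintype.card A ^ t)) := by
  obtain ⟨c, -, hc⟩ := Finset.exists_le_card_fiber_of_nsmul_le_card_of_maps_to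
    (s := (Finset.univ : Finset (ι → A))) (t := Finset.range (B + 1)) (f := f)
    (b := (Fintype.card A : ℝ) ^ Fintype.card ι / (B + 1))
    (fun u _ ↦ Finset.mem_range.2 (Nat.lt_succ_of_le (hf u))) ⟨0, by simp⟩ (by
      rw [nsmul_eq_mul, Finset.card_range]
      push_cast
      rw [mul_div_cancel₀ _ (by positivity)]
      simp)
  obtain ⟨C, hCS, hsep, hcard⟩ := exists_pairwise_not_rel_card_le
    (Finset.univ.filter fun u ↦ f u = c) (fun u v ↦ hammingDist u v ≤ t) (by simp)
    (fun u v h ↦ by rwa [hammingDist_comm]) _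
    (fun u ↦ (Finset.card_le_card (Finset.filter_subset_filter _
      (Finset.subset_univ _))).trans (card_hammingDist_le u t))
  refine ⟨C, fun u hu v hv ↦ ?_, fun u hu v hv huv ↦ not_le.1 (hsep u hu v hv huv), ?_⟩
  · rw [(Finset.mem_filter.1 (hCS hu)).2, (Finset.mem_filter.1 (hCS hv)).2]
  · rw [div_le_iff₀' (by positivity)] at hc
    refine hc.trans ?_
    gcongr
    exact_mod_cast hcard

end Separation

/-! ### Identification codes of a given block length -/

section Codes

variable {X Y : Type*} [Fintype Y] (W : X → stdSimplex ℝ Y)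

/-- The vector `√(W_x)` of square roots of output probabilities, a point of the unit sphere. -/
noncomputable def sqrtOutput (x : X) : EuclideanSpace ℝ Y :=
  WithLp.toLp 2 fun y : Y ↦ √((W x : Y → ℝ) y)

lemma dist_sqrtOutput_sq (x x' : X) : dist (sqrtOutput W x) (sqrtOutput W x') ^ 2 =
    ∑ b, (√((W x : Y → ℝ) b) - √((W x' : Y → ℝ) b)) ^ 2 := by
  rw [EuclideanSpace.dist_sq_eq]
  simp [sqrtOutput, Real.dist_eq]

lemma output_nonneg (x : X) (b : Y) : 0 ≤ (W x : Y → ℝ) b := (W x).2.1 b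

lemma sum_output (x : X) : ∑ b, (W x : Y → ℝ) b = 1 := (W x).2.2

/-- Words with almost equal output entropies and large Hellinger distances are the code words of a
DI code, with the typical sets of their output distributions as decoding sets. -/
lemma nonempty_DICode_of_separated {n N : ℕ} (u : Fin N → Fin n → X) {T L D lam₁ lam₂ : ℝ}
    (hT : 0 < T)
    (hent : ∀ j k, |prodEntropy (fun i ↦ (W (u j i) : Y → ℝ)) -
      prodEntropy (fun i ↦ (W (u k i) : Y → ℝ))| ≤ L)
    (hdist : ∀ j k, j ≠ k → D ≤ ∑ i, dist (sqrtOutput W (u j i)) (sqrtOutput W (u k i)) ^ 2)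
    (h₁ : 4 * n * Fintype.card Y / T ^ 2 ≤ lam₁)
    (h₂ : 4 * n * Fintype.card Y / T ^ 2 + Real.exp (T + L / 2 - D / 2) ≤ lam₂) :
    Nonempty (DICode W n N lam₁ lam₂) := by
  classical
  refine ⟨⟨u, fun j ↦ typicalSet (fun i ↦ (W (u j i) : Y → ℝ)) T, fun j ↦ ?_,
    fun j k hjk ↦ ?_⟩⟩
  · have h := sum_compl_typicalSet_le (p := fun i ↦ (W (u j i) : Y → ℝ))
      (fun i ↦ output_nonneg W _) (fun i ↦ sum_output W _) hT
    have hs := Finset.sum_add_sum_compl (typicalSet (fun i ↦ (W (u j i) : Y → ℝ)) T)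
      fun y ↦ ∏ i, (W (u j i) : Y → ℝ) (y i)
    rw [sum_prod_eq_prod_sum (fun i ↦ (W (u j i) : Y → ℝ))] at hs
    simp only [sum_output, Finset.prod_const_one] at hs
    rw [Fintype.card_fin] at h
    rw [blockProb]
    linarith
  · have h := sum_typicalSet_le (p := fun i ↦ (W (u k i) : Y → ℝ))
      (q := fun i ↦ (W (u j i) : Y → ℝ))
      (fun i ↦ output_nonneg W _) (fun i ↦ sum_output W _)
      (fun i ↦ output_nonneg W _) (fun i ↦ sum_output W _) hT (hent k j)
    simp only [← dist_sqrtOutput_sq, Fintype.card_fin] at h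
    refine h.trans (le_trans ?_ h₂)
    gcongr
    exact hdist k j hjk.symm

/-- If two natural floors agree, so do the numbers, up to the width of a bin. -/
lemma abs_sub_le_of_floor_div_eq {a b w : ℝ} (hw : 0 < w) (ha : 0 ≤ a) (hb : 0 ≤ b)
    (h : ⌊a / w⌋₊ = ⌊b / w⌋₊) : |a - b| ≤ w := by
  have ha1 := Nat.floor_le (div_nonneg ha hw.le)
  have ha2 := Nat.lt_floor_add_one (a / w)
  have hb1 := Nat.floor_le (div_nonneg hb hw.le)
  have hb2 := Nat.lt_floor_add_one (b / w)
  rw [h] at ha1 ha2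
  have h1 : |a / w - b / w| ≤ 1 := by
    rw [abs_le]
    constructor <;> linarith
  rwa [← sub_div, abs_div, abs_of_pos hw, div_le_one hw] at h1

/-- The finite-length coding theorem: a separated set of `m` inputs gives DI codes whose size is
`m ^ n` up to the loss from the minimum Hamming distance and from equalizing the entropies. -/
lemma exists_DICode_of_separated {n : ℕ} (hn : 1 ≤ n) (A : Finset X) {δ : ℝ} (hδ : 0 ≤ δ)
    (hA : ∀ x ∈ A, ∀ x' ∈ A, x ≠ x' → δ ≤ dist (sqrtOutput W x) (sqrtOutput W x'))
    (t : ℕ) {T lam₁ lam₂ : ℝ} (hT : 0 < T)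
    (h₁ : 4 * n * Fintype.card Y / T ^ 2 ≤ lam₁)
    (h₂ : 4 * n * Fintype.card Y / T ^ 2 +
      Real.exp (T + Fintype.card Y * √n / 2 - (t + 1) * δ ^ 2 / 2) ≤ lam₂) :
    ∃ N, Nonempty (DICode W n N lam₁ lam₂) ∧
      (A.card : ℝ) ^ n ≤ (n + 1) * (N * (2 ^ n * A.card ^ t)) := by
  classical
  rcases A.eq_empty_or_nonempty with rfl | ⟨x₀, hx₀⟩
  · refine ⟨0, nonempty_DICode_of_separated W (L := Fintype.card Y * √n) (D := (t + 1) * δ ^ 2)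
      (fun j ↦ j.elim0) hT (fun j ↦ j.elim0) (fun j ↦ j.elim0) h₁ h₂, ?_⟩
    simp [show n ≠ 0 by omega]
  have hY : 0 < Fintype.card Y := by
    rw [Fintype.card_pos_iff]
    by_contra h
    rw [not_nonempty_iff] at h
    simpa using sum_output W x₀
  have hw : (0 : ℝ) < Fintype.card Y * √n := by positivity
  have : Nonempty A := ⟨⟨x₀, hx₀⟩⟩
  set H : (Fin n → A) → ℝ := fun u ↦ prodEntropy (fun i ↦ (W (u i) : Y → ℝ)) with hH
  have hH0 : ∀ u, 0 ≤ H u := fun u ↦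
    prodEntropy_nonneg (fun i ↦ output_nonneg W _) (fun i ↦ sum_output W _)
  have hH1 : ∀ u, H u ≤ n * Fintype.card Y := fun u ↦ by
    simpa using prodEntropy_le (p := fun i ↦ (W (u i) : Y → ℝ))
      (fun i ↦ output_nonneg W _) (fun i ↦ sum_output W _)
  -- The entropies lie in `[0, n |Y|]`, so bins of width `|Y| √n` have indices at most `√n ≤ n`.
  have hbin : ∀ u, ⌊H u / (Fintype.card Y * √n)⌋₊ ≤ n := by
    intro u
    refine Nat.floor_le_of_le ?_
    rw [div_le_iff₀ hw]
    have hs : (1 : ℝ) ≤ √n := by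
      rw [Real.one_le_sqrt]
      exact_mod_cast hn
    calc H u ≤ n * Fintype.card Y * 1 := by rw [mul_one]; exact hH1 u
      _ ≤ n * Fintype.card Y * √n := by gcongr
      _ = _ := by ring
  obtain ⟨C, hCH, hCd, hcard⟩ := exists_hamming_code
    (fun u : Fin n → A ↦ ⌊H u / (Fintype.card Y * √n)⌋₊) n t hbin
  refine ⟨C.card, ?_, by simpa using hcard⟩
  refine nonempty_DICode_of_separated W (L := Fintype.card Y * √n) (D := (t + 1) * δ ^ 2)
    (fun j i ↦ ((C.equivFin.symm j).1 i : X)) hT (fun j k ↦ ?_) (fun j k hjk ↦ ?_)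
    h₁ h₂
  · exact abs_sub_le_of_floor_div_eq hw (hH0 _) (hH0 _)
      (hCH _ (C.equivFin.symm j).2 _ (C.equivFin.symm k).2)
  · set v : Fin n → A := (C.equivFin.symm j).1
    set w : Fin n → A := (C.equivFin.symm k).1
    have hvw : v ≠ w := fun h ↦ hjk (C.equivFin.symm.injective (Subtype.ext h))
    have hd := hCd v (C.equivFin.symm j).2 w (C.equivFin.symm k).2 hvw
    have hd' : (t + 1 : ℝ) ≤ hammingDist v w := by exact_mod_cast hd
    calc (t + 1) * δ ^ 2 ≤ hammingDist v w * δ ^ 2 := by gcongr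
      _ = ∑ i with v i ≠ w i, δ ^ 2 := by simp [hammingDist]
      _ ≤ ∑ i with v i ≠ w i, dist (sqrtOutput W (v i)) (sqrtOutput W (w i)) ^ 2 := by
          refine Finset.sum_le_sum fun i hi ↦ ?_
          rw [Finset.mem_filter] at hi
          exact pow_le_pow_left₀ hδ (hA _ (v i).2 _ (w i).2 fun h ↦ hi.2 (Subtype.ext h)) 2
      _ ≤ _ := Finset.sum_le_sum_of_subset_of_nonneg (Finset.subset_univ _)
          fun i _ _ ↦ sq_nonneg _

/-- Two code words of a DI code cannot be close letter by letter: their output distributions would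
be indistinguishable. -/
lemma DICode.sq_le_sum_dist_sq {n N : ℕ} {lam₁ lam₂ : ℝ} (c : DICode W n N lam₁ lam₂)
    (h : lam₁ + lam₂ < 1) {j k : Fin N} (hjk : j ≠ k) :
    (1 - lam₁ - lam₂) ^ 2 ≤
      4 * ∑ i, dist (sqrtOutput W (c.u j i)) (sqrtOutput W (c.u k i)) ^ 2 := by
  have h1 := c.first_kind j
  have h2 := c.second_kind k j hjk.symm
  have h3 := sq_sum_sub_sum_le (p := fun i ↦ (W (c.u j i) : Y → ℝ))
      (q := fun i ↦ (W (c.u k i) : Y → ℝ))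
      (fun i ↦ output_nonneg W _) (fun i ↦ sum_output W _)
      (fun i ↦ output_nonneg W _) (fun i ↦ sum_output W _) (c.E j)
  simp only [← dist_sqrtOutput_sq] at h3
  refine le_trans (pow_le_pow_left₀ (by linarith) ?_ 2) h3
  rw [blockProb] at h1 h2
  linarith

/-- The converse at finite length: rounding the letters of the code words to the centres of a
covering is injective on a DI code. -/
lemma maxSize_le_coveringNumber_pow {n : ℕ} {lam₁ lam₂ : ℝ} (h : lam₁ + lam₂ < 1) {δ : ℝ≥0}
    (hδ : 16 * n * (δ : ℝ) ^ 2 < (1 - lam₁ - lam₂) ^ 2)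
    (hfin : Metric.coveringNumber δ (sqrtOutputSet W) ≠ ⊤) :
    maxSize W n lam₁ lam₂ ≤ Metric.coveringNumber δ (sqrtOutputSet W) ^ n := by
  obtain ⟨C, -, hCfin, hcov, hcard⟩ := Metric.exists_set_encard_eq_coveringNumber hfin
  have hex : ∀ x, ∃ z : C, dist (sqrtOutput W x) z ≤ δ := by
    intro x
    obtain ⟨z, hz, hd⟩ := hcov ⟨x, rfl⟩
    refine ⟨⟨z, hz⟩, ?_⟩
    have hd' : edist (sqrtOutput W x) z ≤ δ := hd
    rwa [edist_nndist, ENNReal.coe_le_coe, ← NNReal.coe_le_coe, coe_nndist] at hd'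
  choose f hf using hex
  refine iSup₂_le fun N ⟨c⟩ ↦ ?_
  have hinj : Function.Injective fun (j : Fin N) (i : Fin n) ↦ f (c.u j i) := by
    intro j k hjk
    by_contra hne
    have h1 := c.sq_le_sum_dist_sq W h hne
    have h2 : ∑ i, dist (sqrtOutput W (c.u j i)) (sqrtOutput W (c.u k i)) ^ 2 ≤
        ∑ _i : Fin n, (2 * (δ : ℝ)) ^ 2 := by
      refine Finset.sum_le_sum fun i _ ↦ pow_le_pow_left₀ dist_nonneg ?_ 2
      have h3 := hf (c.u j i)
      have h4 := hf (c.u k i)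
      have h5 : f (c.u j i) = f (c.u k i) := congrFun hjk i
      rw [← h5] at h4
      linarith [dist_triangle_right (sqrtOutput W (c.u j i)) (sqrtOutput W (c.u k i))
        (f (c.u j i))]
    simp only [Finset.sum_const, Finset.card_univ, Fintype.card_fin, nsmul_eq_mul] at h2
    nlinarith
  have : Fintype C := hCfin.fintype
  have hN := Fintype.card_le_of_injective _ hinj
  rw [Fintype.card_fin, Fintype.card_fun, Fintype.card_fin] at hN
  rw [← hcard, Set.encard_eq_coe_toFinset_card, Set.toFinset_card]
  exact_mod_cast hN

lemma one_le_maxSize [Nonempty X] (n : ℕ) {lam₁ lam₂ : ℝ} (h : 0 ≤ lam₁) :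
    1 ≤ maxSize W n lam₁ lam₂ := by
  obtain ⟨x⟩ := ‹Nonempty X›
  refine le_iSup₂_of_le 1 ⟨⟨fun _ _ ↦ x, fun _ ↦ Finset.univ, fun j ↦ ?_,
    fun j k hjk ↦ absurd (Subsingleton.elim j k) hjk⟩⟩ (by simp)
  rw [blockProb, sum_prod_eq_prod_sum (fun _ ↦ (W x : Y → ℝ))]
  simp [h]

end Codes

/-! ### Asymptotic rates and the Minkowski dimension -/

section Rates

variable {X Y : Type*} [Fintype Y] (W : X → stdSimplex ℝ Y)

lemma exists_separated_of_le_coveringNumber {δ : ℝ≥0} {m : ℕ}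
    (h : (m : ℕ∞) ≤ Metric.coveringNumber δ (sqrtOutputSet W)) :
    ∃ A : Finset X, A.card = m ∧
      ∀ x ∈ A, ∀ x' ∈ A, x ≠ x' → (δ : ℝ) ≤ dist (sqrtOutput W x) (sqrtOutput W x') := by
  classical
  rcases Nat.eq_zero_or_eq_succ_pred m with hm | hm
  · exact ⟨∅, by simp [hm], by simp⟩
  have hlt : ((m.pred : ℕ) : ℕ∞) < Metric.packingNumber δ (sqrtOutputSet W) :=
    lt_of_lt_of_le (by exact_mod_cast (by omega : m.pred < m))
      (h.trans (Metric.coveringNumber_le_packingNumber δ _))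
  simp only [Metric.packingNumber, lt_iSup_iff] at hlt
  obtain ⟨C, hC, hsep, hlt⟩ := hlt
  have hle : (m : ℕ∞) ≤ C.encard := by
    rw [hm, Nat.cast_succ]
    exact Order.add_one_le_of_lt hlt
  obtain ⟨D, hDC, hD⟩ := Set.exists_subset_encard_eq hle
  have hDfin : D.Finite := Set.finite_of_encard_eq_coe hD
  have hpre : ∀ z : D, ∃ x, sqrtOutput W x = z := fun z ↦ hC (hDC z.2)
  choose f hf using hpre
  have hfinj : Function.Injective f := fun z z' hz ↦ by
    rw [Subtype.ext_iff, ← hf z, ← hf z', hz]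
  have : Fintype D := hDfin.fintype
  refine ⟨Finset.univ.image f, ?_, ?_⟩
  · rw [Finset.card_image_of_injective _ hfinj, Finset.card_univ, ← Set.toFinset_card]
    rw [Set.encard_eq_coe_toFinset_card] at hD
    exact_mod_cast hD
  · intro x hx x' hx' hne
    obtain ⟨z, -, rfl⟩ := Finset.mem_image.1 hx
    obtain ⟨z', -, rfl⟩ := Finset.mem_image.1 hx'
    rw [hf, hf]
    have hzz : (z : EuclideanSpace ℝ Y) ≠ z' := fun h ↦ hne (by rw [Subtype.ext h])
    have h3 : (δ : ℝ≥0∞) < edist (z : EuclideanSpace ℝ Y) z' :=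
      hsep (hDC z.2) (hDC z'.2) hzz
    rw [edist_nndist, ENNReal.coe_lt_coe, ← NNReal.coe_lt_coe, coe_nndist] at h3
    exact h3.le

/-- Stated with a natural number below the covering number `Γ`, so that the covering number need not
be finite. -/
lemma ceil_rpow_le_of_lt_log_div {r : ℝ} {δ : ℝ≥0} (hδ0 : 0 < δ) (hδ1 : δ < 1) {Γ : ℕ∞}
    (h : (r : EReal) < ENNReal.log (Γ : ℝ≥0∞) / ((-Real.log δ : ℝ) : EReal)) :
    ((⌈(δ : ℝ) ^ (-r)⌉₊ : ℕ) : ℕ∞) ≤ Γ := by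
  have hδ0' : (0 : ℝ) < δ := by exact_mod_cast hδ0
  have hlog : 0 < -Real.log δ := by
    have := Real.log_neg hδ0' (by exact_mod_cast hδ1)
    linarith
  rw [EReal.lt_div_iff (by exact_mod_cast hlog) (EReal.coe_ne_top _)] at h
  cases Γ with
  | top => exact le_top
  | coe k =>
    have hpos : 0 < (δ : ℝ) ^ (-r) := Real.rpow_pos_of_pos hδ0' _
    have e : ((r : EReal) * ((-Real.log δ : ℝ) : EReal)) =
        ENNReal.log (ENNReal.ofReal ((δ : ℝ) ^ (-r))) := by
      rw [ENNReal.log_ofReal_of_pos hpos, Real.log_rpow hδ0', ← EReal.coe_mul]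
      congr 1
      ring
    rw [e, ENNReal.log_lt_log_iff] at h
    have h2 : (δ : ℝ) ^ (-r) ≤ k := by
      have h3 : ENNReal.ofReal ((δ : ℝ) ^ (-r)) ≤ (k : ℝ≥0∞) := by simpa using h.le
      rwa [← ENNReal.ofReal_natCast, ENNReal.ofReal_le_ofReal_iff (Nat.cast_nonneg k)] at h3
    exact_mod_cast Nat.ceil_le.2 h2

lemma log_natCast_toENNReal {N : ℕ} (hN : 0 < N) :
    ENNReal.log ((N : ℕ∞) : ℝ≥0∞) = ((Real.log N : ℝ) : EReal) := by
  have : (((N : ℕ∞) : ℝ≥0∞)) = ENNReal.ofReal (N : ℝ) := by simp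
  rw [this, ENNReal.log_ofReal_of_pos (by exact_mod_cast hN)]

/-- With `δ = n ^ (-(1/4 - θ))` and minimum Hamming distance `θ n`, the squared Hellinger distance
of two code words is at least `θ n ^ (1/2 + 2θ)`, which beats the fluctuations of order `√n`
of the information content. -/
lemma eventually_exp_le {θ K b ε : ℝ} (hθ : 0 < θ) (hε : 0 < ε) :
    ∀ᶠ n : ℕ in atTop, Real.exp (K * √n + b * √n / 2 -
      (⌊θ * n⌋₊ + 1) * ((n : ℝ) ^ (-(1 / 4 - θ))) ^ 2 / 2) ≤ ε := by
  have h1 : Tendsto (fun n : ℕ ↦ (n : ℝ) ^ (2 * θ)) atTop atTop :=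
    (tendsto_rpow_atTop (by positivity)).comp tendsto_natCast_atTop_atTop
  have h2 : Tendsto (fun n : ℕ ↦ √(n : ℝ)) atTop atTop :=
    Real.tendsto_sqrt_atTop.comp tendsto_natCast_atTop_atTop
  filter_upwards [h1.eventually_ge_atTop (2 * (K + b / 2 + 1) / θ),
    h2.eventually_ge_atTop (-Real.log ε), eventually_ge_atTop 1] with n hn1 hn2 hn
  have hn0 : (0 : ℝ) < n := by exact_mod_cast hn
  rw [← Real.le_log_iff_exp_le hε]
  have e : θ * n * ((n : ℝ) ^ (-(1 / 4 - θ))) ^ 2 = θ * (√n * (n : ℝ) ^ (2 * θ)) := by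
    rw [← Real.rpow_natCast, ← Real.rpow_mul hn0.le, Real.sqrt_eq_rpow, mul_assoc,
      ← Real.rpow_add hn0]
    nth_rewrite 1 [← Real.rpow_one (n : ℝ)]
    rw [← Real.rpow_add hn0]
    congr 2
    push_cast
    ring
  have hfl : θ * n ≤ ⌊θ * n⌋₊ + 1 := (Nat.lt_floor_add_one _).le
  have hge : θ * (√n * (n : ℝ) ^ (2 * θ)) ≤
      (⌊θ * n⌋₊ + 1) * ((n : ℝ) ^ (-(1 / 4 - θ))) ^ 2 := by
    rw [← e]
    gcongr
  rw [div_le_iff₀ hθ] at hn1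
  have h3 := mul_le_mul_of_nonneg_left hn1 (Real.sqrt_nonneg n)
  nlinarith

/-- The coding theorem, before the slack `θ` in the exponents is removed. -/
lemma le_pessimisticRate_of_lt {r θ lam₁ lam₂ : ℝ} (hr : 0 < r) (hθ : 0 < θ) (hθ' : θ < 1 / 4)
    (hrd : (r : EReal) < lowerMinkowskiDim (sqrtOutputSet W)) (h₁ : 0 < lam₁) (h₂ : 0 < lam₂) :
    (((1 - θ) * (r * (1 / 4 - θ)) - θ : ℝ) : EReal) ≤ pessimisticRate W lam₁ lam₂ := by
  have hev := eventually_lt_of_lt_liminf hrd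
  set d : ℕ → ℝ≥0 := fun n ↦ (n : ℝ≥0) ^ (-(1 / 4 - θ)) with hd
  have hd0 : Tendsto d atTop (𝓝 0) := by
    have := (tendsto_rpow_neg_atTop (by linarith : 0 < 1 / 4 - θ)).comp
      (tendsto_natCast_atTop_atTop (R := ℝ))
    rw [← NNReal.tendsto_coe]
    simpa [hd, Function.comp_def] using this
  have hdpos : ∀ᶠ n : ℕ in atTop, 0 < d n := by
    filter_upwards [eventually_ge_atTop 1] with n hn
    exact NNReal.rpow_pos (by exact_mod_cast hn)
  have hd' : Tendsto d atTop (𝓝[>] 0) := tendsto_nhdsWithin_iff.2 ⟨hd0, hdpos⟩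
  -- `K` makes the Chebyshev bound `4 |Y| / K ^ 2` at most `min lam₁ (lam₂ / 2)`.
  obtain ⟨K, hK0, hK⟩ : ∃ K : ℝ, 0 < K ∧ 4 * Fintype.card Y / K ^ 2 ≤ min lam₁ (lam₂ / 2) := by
    have hm : 0 < min lam₁ (lam₂ / 2) := lt_min h₁ (by linarith)
    refine ⟨√(4 * (Fintype.card Y + 1) / min lam₁ (lam₂ / 2)), by positivity, ?_⟩
    rw [Real.sq_sqrt (by positivity), div_le_iff₀ (by positivity), mul_div_cancel₀ _ hm.ne']
    linarith
  -- For such `n` the loss `n log 2 + log (n + 1) ≤ n (log 2 + 1)` is at most `θ n log n`.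
  have hlog : ∀ᶠ n : ℕ in atTop, (Real.log 2 + 1) / θ ≤ Real.log n :=
    (Real.tendsto_log_atTop.comp tendsto_natCast_atTop_atTop).eventually_ge_atTop _
  refine le_liminf_of_le (by isBoundedDefault) ?_
  filter_upwards [hd'.eventually hev, hdpos, hd0.eventually_lt_const zero_lt_one, hlog,
    eventually_ge_atTop 2,
    eventually_exp_le (K := K) (b := Fintype.card Y) hθ (half_pos h₂)] with
    n hn1 hn2 hn3 hn4 hn5 hn6
  have hn0 : (0 : ℝ) < n := by positivity
  have hlogn : 0 < Real.log n := Real.log_pos (by exact_mod_cast hn5)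
  have hdn : (d n : ℝ) = (n : ℝ) ^ (-(1 / 4 - θ)) := by simp [hd]
  obtain ⟨A, hAcard, hA⟩ := exists_separated_of_le_coveringNumber W
    (ceil_rpow_le_of_lt_log_div hn2 hn3 hn1)
  have hT : 4 * n * Fintype.card Y / (K * √n) ^ 2 ≤ min lam₁ (lam₂ / 2) := by
    rw [mul_pow, Real.sq_sqrt hn0.le]
    refine le_trans (le_of_eq ?_) hK
    field_simp
  obtain ⟨N, hN, hsize⟩ := exists_DICode_of_separated W (by omega : 1 ≤ n) A (d n).2 hA
    ⌊θ * n⌋₊ (T := K * √n) (lam₁ := lam₁) (lam₂ := lam₂) (by positivity)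
    (hT.trans (min_le_left _ _)) (by
      change _ + Real.exp (_ - _ * (d n : ℝ) ^ 2 / 2) ≤ _
      rw [hdn]
      linarith [hT.trans (min_le_right _ _)])
  have hA1 : (n : ℝ) ^ (r * (1 / 4 - θ)) ≤ A.card := by
    rw [hAcard, hdn]
    refine le_trans (le_of_eq ?_) (Nat.le_ceil _)
    rw [← Real.rpow_mul hn0.le]
    congr 1
    ring
  have hApos : (0 : ℝ) < A.card := lt_of_lt_of_le (Real.rpow_pos_of_pos hn0 _) hA1
  have hlogA : r * (1 / 4 - θ) * Real.log n ≤ Real.log A.card := by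
    rw [← Real.log_rpow hn0]
    exact Real.log_le_log (Real.rpow_pos_of_pos hn0 _) hA1
  have hNpos : 0 < N := by
    rcases Nat.eq_zero_or_pos N with h | h
    · rw [h] at hsize
      have := pow_pos hApos n
      simp only [Nat.cast_zero, zero_mul, mul_zero] at hsize
      linarith
    · exact h
  have hNpos' : (0 : ℝ) < N := by exact_mod_cast hNpos
  have hlogs := Real.log_le_log (pow_pos hApos n) hsize
  rw [Real.log_mul (by positivity) (by positivity), Real.log_mul (by positivity) (by positivity),
    Real.log_mul (by positivity) (by positivity), Real.log_pow, Real.log_pow, Real.log_pow]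
    at hlogs
  have hlog1 : Real.log (n + 1) ≤ n := by
    have := Real.log_le_sub_one_of_pos (by positivity : (0 : ℝ) < n + 1)
    linarith
  have hfl : (⌊θ * n⌋₊ : ℝ) ≤ θ * n := Nat.floor_le (by positivity)
  have hlogA0 : 0 ≤ Real.log A.card :=
    le_trans (by have : 0 < 1 / 4 - θ := by linarith
                 positivity) hlogA
  have hmain : ((1 - θ) * (r * (1 / 4 - θ)) - θ) * (n * Real.log n) ≤ Real.log N := by
    rw [div_le_iff₀ hθ] at hn4
    have e1 := mul_le_mul_of_nonneg_right hfl hlogA0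
    have e2 := mul_le_mul_of_nonneg_left hlogA
      (by nlinarith : 0 ≤ (1 - θ) * (n : ℝ))
    have e3 := mul_le_mul_of_nonneg_left hn4 hn0.le
    nlinarith
  rw [EReal.le_div_iff_mul_le (by exact_mod_cast (by positivity : (0 : ℝ) < n * Real.log n))
    (EReal.coe_ne_top _), ← EReal.coe_mul]
  calc _ ≤ ((Real.log N : ℝ) : EReal) := EReal.coe_le_coe_iff.2 hmain
    _ = ENNReal.log ((N : ℕ∞) : ℝ≥0∞) := (log_natCast_toENNReal hNpos).symm
    _ ≤ _ := ENNReal.log_le_log (ENat.toENNReal_mono (le_iSup₂_of_le N hN le_rfl))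

lemma pessimisticRate_nonneg [Nonempty X] {lam₁ lam₂ : ℝ} (h₁ : 0 ≤ lam₁) :
    0 ≤ pessimisticRate W lam₁ lam₂ := by
  refine le_liminf_of_le (by isBoundedDefault) (Eventually.of_forall fun n ↦ ?_)
  refine EReal.div_nonneg ?_ ?_
  · rw [ENNReal.zero_le_log_iff, ← ENat.toENNReal_one]
    exact ENat.toENNReal_mono (one_le_maxSize W n h₁)
  · exact_mod_cast mul_nonneg (Nat.cast_nonneg n) (Real.log_natCast_nonneg n)

lemma lowerMinkowskiDim_nonneg {M : Type*} [MetricSpace M] {F : Set M} (hF : F.Nonempty) :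
    0 ≤ lowerMinkowskiDim F := by
  refine le_liminf_of_le (by isBoundedDefault) ?_
  filter_upwards [nhdsWithin_le_nhds (gt_mem_nhds (zero_lt_one (α := ℝ≥0)))] with δ hδ
  refine EReal.div_nonneg ?_ ?_
  · rw [ENNReal.zero_le_log_iff, ← ENat.toENNReal_one]
    exact ENat.toENNReal_mono (Order.one_le_iff_pos.2 (Metric.coveringNumber_pos_iff.2 hF))
  · have := Real.log_nonpos δ.2 (by exact_mod_cast hδ.le : (δ : ℝ) ≤ 1)
    exact_mod_cast neg_nonneg.2 this

/-- The direct part, from `le_pessimisticRate_of_lt` in the limit `θ → 0`. -/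
theorem quarter_lowerMinkowskiDim_le_pessimisticRate [Nonempty X] {lam₁ lam₂ : ℝ} (h₁ : 0 < lam₁)
    (h₂ : 0 < lam₂) :
    ((1 / 4 : ℝ) : EReal) * lowerMinkowskiDim (sqrtOutputSet W) ≤ pessimisticRate W lam₁ lam₂ := by
  have key : ∀ r : ℝ, (r : EReal) < lowerMinkowskiDim (sqrtOutputSet W) →
      ((r / 4 : ℝ) : EReal) ≤ pessimisticRate W lam₁ lam₂ := by
    intro r hrd
    rcases le_or_gt r 0 with hr | hr
    · exact le_trans (by exact_mod_cast (by linarith : r / 4 ≤ 0))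
        (pessimisticRate_nonneg W h₁.le)
    have hlim : Tendsto (fun θ : ℝ ↦ (((1 - θ) * (r * (1 / 4 - θ)) - θ : ℝ) : EReal))
        (𝓝[>] 0) (𝓝 ((r / 4 : ℝ) : EReal)) := by
      refine (continuous_coe_real_ereal.tendsto _).comp (tendsto_nhdsWithin_of_tendsto_nhds ?_)
      have : Continuous fun θ : ℝ ↦ (1 - θ) * (r * (1 / 4 - θ)) - θ := by fun_prop
      convert! this.tendsto 0 using 2
      ring
    refine le_of_tendsto hlim ?_
    filter_upwards [Ioo_mem_nhdsGT (by norm_num : (0 : ℝ) < 1 / 4)] with θ hθ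
    exact le_pessimisticRate_of_lt W hr hθ.1 hθ.2 hrd h₁ h₂
  rw [mul_comm, ← EReal.le_div_iff_mul_le (by exact_mod_cast (by norm_num : (0 : ℝ) < 1 / 4))
    (EReal.coe_ne_top _)]
  refine EReal.ge_of_forall_gt_iff_ge.1 fun r hr ↦ ?_
  rw [EReal.le_div_iff_mul_le (by exact_mod_cast (by norm_num : (0 : ℝ) < 1 / 4))
    (EReal.coe_ne_top _), ← EReal.coe_mul, mul_one_div]
  exact key r hr

/-- The converse: the block length `n = ⌊c / δ ^ 2⌋` is matched to a covering radius `δ` at which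
the covering number is small, and the loss in rounding `n` disappears in `log n`. -/
theorem pessimisticRate_le_half_lowerMinkowskiDim [Nonempty X] {lam₁ lam₂ : ℝ}
    (h : lam₁ + lam₂ < 1) :
    pessimisticRate W lam₁ lam₂ ≤ ((1 / 2 : ℝ) : EReal) * lowerMinkowskiDim (sqrtOutputSet W) := by
  have hhalf : (0 : EReal) < ((1 / 2 : ℝ) : EReal) := by
    exact_mod_cast (by norm_num : (0 : ℝ) < 1 / 2)
  have key : ∀ a z : ℝ, lowerMinkowskiDim (sqrtOutputSet W) < a → a / 2 < z →
      pessimisticRate W lam₁ lam₂ ≤ z := by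
    intro a z had haz
    have ha : 0 < a := by
      have hne : (sqrtOutputSet W).Nonempty := Set.range_nonempty _
      have := (lowerMinkowskiDim_nonneg hne).trans_lt had
      exact_mod_cast this
    have hfreq := frequently_lt_of_liminf_lt (by isBoundedDefault) had
    -- Half of the constant that `maxSize_le_coveringNumber_pow` allows, to get a strict inequality.
    set c : ℝ := (1 - lam₁ - lam₂) ^ 2 / 32 with hc
    have hl : 0 < (1 - lam₁ - lam₂) ^ 2 := pow_pos (by linarith) 2
    have hc0 : 0 < c := by positivity
    have htend : Tendsto (fun δ : ℝ≥0 ↦ ⌊c / (δ : ℝ) ^ 2⌋₊) (𝓝[>] 0) atTop := by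
      refine tendsto_nat_floor_atTop.comp (Tendsto.const_mul_atTop hc0 ?_)
      refine tendsto_inv_nhdsGT_zero.comp (tendsto_nhdsWithin_iff.2 ⟨?_, ?_⟩)
      · refine tendsto_nhdsWithin_of_tendsto_nhds ?_
        have : Continuous fun δ : ℝ≥0 ↦ (δ : ℝ) ^ 2 := by fun_prop
        simpa using this.tendsto 0
      · filter_upwards [self_mem_nhdsWithin] with δ hδ
        have : (0 : ℝ) < δ := by exact_mod_cast hδ
        exact pow_pos this 2
    -- For such `n`, the bound `-log δ ≤ (log (2 n) - log c) / 2` implies `a * -log δ ≤ z * log n`.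
    have hlog : ∀ᶠ n : ℕ in atTop, a / 2 * (Real.log 2 - Real.log c) / (z - a / 2) ≤ Real.log n :=
      (Real.tendsto_log_atTop.comp tendsto_natCast_atTop_atTop).eventually_ge_atTop _
    have hsmall : ∀ᶠ δ : ℝ≥0 in 𝓝[>] 0, 0 < δ ∧ δ < 1 := Ioo_mem_nhdsGT zero_lt_one
    refine liminf_le_of_frequently_le' (htend.frequently
      ((hfreq.and_eventually ((htend.eventually (hlog.and (eventually_ge_atTop 2))).and
        hsmall)).mono ?_))
    rintro δ ⟨hΓ, ⟨hn1, hn2⟩, hδ0, hδ1⟩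
    have hδ0' : (0 : ℝ) < δ := by exact_mod_cast hδ0
    have hlogδ : 0 < -Real.log δ := by
      have := Real.log_neg hδ0' (by exact_mod_cast hδ1)
      linarith
    set n := ⌊c / (δ : ℝ) ^ 2⌋₊ with hn
    have hn0 : (0 : ℝ) < n := by positivity
    have hlogn : 0 < Real.log n := Real.log_pos (by exact_mod_cast hn2)
    rw [EReal.div_lt_iff (by exact_mod_cast hlogδ) (EReal.coe_ne_top _)] at hΓ
    have hfin : Metric.coveringNumber δ (sqrtOutputSet W) ≠ ⊤ := by
      intro htop
      rw [htop] at hΓ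
      simp at hΓ
    have hnle : n * (δ : ℝ) ^ 2 ≤ c := by
      rw [← le_div_iff₀ (by positivity)]
      exact Nat.floor_le (by positivity)
    have hnlt : c < (n + 1) * (δ : ℝ) ^ 2 := by
      rw [← div_lt_iff₀ (by positivity)]
      exact Nat.lt_floor_add_one _
    have hmax := maxSize_le_coveringNumber_pow W (n := n) h (δ := δ) (by nlinarith) hfin
    rw [EReal.div_le_iff_le_mul (by exact_mod_cast (by positivity : (0 : ℝ) < n * Real.log n))
      (EReal.coe_ne_top _)]
    have hlogc : -Real.log δ ≤ (Real.log 2 + Real.log n - Real.log c) / 2 := by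
      have h1 := Real.log_le_log hc0 hnlt.le
      rw [Real.log_mul (by positivity) (by positivity), Real.log_pow] at h1
      have h2 : Real.log (n + 1) ≤ Real.log (2 * n) := by
        apply Real.log_le_log (by positivity)
        have : (2 : ℝ) ≤ n := by exact_mod_cast hn2
        linarith
      rw [Real.log_mul (by norm_num) (by positivity)] at h2
      push_cast at h1
      linarith
    have hreal : n * (a * -Real.log δ) ≤ n * Real.log n * z := by
      rw [mul_assoc]
      refine mul_le_mul_of_nonneg_left ?_ hn0.le
      rw [div_le_iff₀ (by linarith)] at hn1
      have := mul_le_mul_of_nonneg_left hlogc ha.le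
      nlinarith
    calc _ ≤ ENNReal.log ((Metric.coveringNumber δ (sqrtOutputSet W) : ℝ≥0∞) ^ n) := by
          refine ENNReal.log_le_log ?_
          rw [← ENat.toENNReal_pow]
          exact ENat.toENNReal_mono hmax
      _ = n * ENNReal.log (Metric.coveringNumber δ (sqrtOutputSet W) : ℝ≥0∞) := ENNReal.log_pow
      _ ≤ n * ((a : EReal) * ((-Real.log δ : ℝ) : EReal)) :=
          mul_le_mul_of_nonneg_left hΓ.le (by positivity)
      _ = ((n * (a * -Real.log δ) : ℝ) : EReal) := by
          rw [EReal.coe_mul, EReal.coe_mul, EReal.coe_natCast]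
      _ ≤ _ := by
          rw [← EReal.coe_mul]
          exact EReal.coe_le_coe_iff.2 hreal
  refine EReal.le_of_forall_lt_iff_le.1 fun z hz ↦ ?_
  have hz' : lowerMinkowskiDim (sqrtOutputSet W) < ((2 * z : ℝ) : EReal) := by
    rw [mul_comm, ← EReal.lt_div_iff hhalf (EReal.coe_ne_top _), ← EReal.coe_div] at hz
    convert! hz using 2
    ring
  obtain ⟨a, ha1, ha2⟩ := EReal.lt_iff_exists_real_btwn.1 hz'
  exact key a z ha1 (by have := EReal.coe_lt_coe_iff.1 ha2; linarith)

end Rates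

end DetIdent

theorem mainTheorem1 {X Y : Type*} [Nonempty X] [Fintype Y] (W : X → stdSimplex ℝ Y)
    (lam₁ lam₂ : ℝ) (h₁ : 0 < lam₁) (h₂ : 0 < lam₂) (h₁₂ : lam₁ + lam₂ < 1) :
    ((1 / 4 : ℝ) : EReal) * DetIdent.lowerMinkowskiDim (DetIdent.sqrtOutputSet W)
        ≤ DetIdent.capacity W ∧
      DetIdent.capacity W ≤ DetIdent.pessimisticRate W lam₁ lam₂ ∧
      DetIdent.pessimisticRate W lam₁ lam₂
        ≤ ((1 / 2 : ℝ) : EReal) * DetIdent.lowerMinkowskiDim (DetIdent.sqrtOutputSet W) := by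
  refine ⟨?_, ?_, DetIdent.pessimisticRate_le_half_lowerMinkowskiDim W h₁₂⟩
  · exact le_iInf fun _ ↦ le_iInf fun _ ↦ le_iInf fun h ↦ le_iInf fun h' ↦
      DetIdent.quarter_lowerMinkowskiDim_le_pessimisticRate W h h'
  · exact iInf_le_of_le lam₁ (iInf_le_of_le lam₂ (iInf_le_of_le h₁ (iInf_le_of_le h₂ le_rfl)))
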